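/- Let $A$ be a separable C*-algebra and $X=\mathrm{Prim}(A)$ its primitive spectrum, i.e. the set of kernels of (nonzero) irreducible representations of $A$, with the Jacobson topology, whose closed sets are the sets $\mathrm{hull}(I)=\{t\in X: I\subseteq t\}$ for $I$ a closed two-sided ideal of $A$. *Rank of a function.* Let $Y$ be a topological space and $w:Y\to\mathbb N\cup\{\infty\}$. By recursion on the ordinal $\alpha$, say that $x\in Y$ has order at most $\alpha$ if there are a neighborhood $U$ of $x$ and $n\in\mathbb N$ such that every $y\in U$ satisfies $w(y)\le n$ or has order at most $\beta$ for some $\beta<\alpha$. (So $x$ has order $0$ if and only if $w$ is bounded by a natural number near $x$.) The order $o_w(x)$ is the least such $\alpha$, and $\infty$ if there is none (in particular if $w(x)=\infty$). The rank of $x$ is $r_w(x)=\omega\cdot o_w(x)+w(x)$, which is $\infty$ if $o_w(x)=\infty$, and the rank of $w$ is $r(w)=\sup_{x\in Y}r_w(x)$. *Pedersen rank.* For $a\in A$ let $w_a:X\to\mathbb N\cup\{\infty\}$, $\mathrm{Ker}(\rho)\mapsto\mathrm{rank}(\rho(a))$. The Pedersen rank of $a$ is $r(w_a)$. For an ordinal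 $\alpha$, the Fell ideal $\Pi_\alpha(A)$ is the closed two-sided ideal of $A$ generated by the elements of Pedersen rank at most $\alpha$. *Fell rank.* A local section around an irreducible representation $\pi$ of $A$ is a pair $(b,U)$ where $b\in A$, $U\subseteq X$ is open, $\mathrm{Ker}(\pi)\in U$, and $\rho(b)\neq 0$ for every irreducible representation $\rho$ with $\mathrm{Ker}(\rho)\in U$. Its Fell rank is the rank of the function $w_b|_U$ on the space $U$. The Fell rank $r_F(\pi)$ is the least of the Fell ranks of the local sections around $\pi$. The Fell rank of a separable C*-algebra is the supremum of the Fell ranks of its irreducible representations. **Proposition.** Let $A$ be a separable C*-algebra and let $\alpha<\omega_1$. Then the closed subset $\mathrm{hull}(\Pi_\alpha(A))$ of $\mathrm{Prim}(A)$ consists exactly of the kernels of the irreducible representations of $A$ of Fell rank greater than $\alpha$. In other words, for every irreducible representation $\pi$ of $A$, $$r_F(\pi)>\alpha\iff \Pi_\alpha(A)\subseteq\mathrm{Ker}(\pi).$$ In particular, $\Pi_\alpha(A)$ is the largest closed two-sided ideal of $A$ of Fell rank at most $\alpha$: the C*-algebra $\Pi_\alpha(A)$ has Fell rank at most $\alpha$,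 and it contains every closed two-sided ideal of $A$ which, as a C*-algebra, has Fell rank at most $\alpha$. -/

import Mathlib

open scoped Ordinal Topology

universe u

noncomputable section

/-! ### Order and rank of a function with values in `ℕ ∪ {∞}` -/

section Weights

/-- The set of points of order at most `α` with respect to `w`. A point `x` belongs to it if and
only if `x` has a neighborhood on which `w` is bounded by some natural number, apart from
points of order strictly less than `α`. For `α = 0` this says that `w` is bounded near `x`.
A point with `w x = ∞` belongs to none of these sets. -/
def weightOrderLE {X : Type*} [TopologicalSpace X] (w : X → ℕ∞) (α : Ordinal.{0}) : Set X :=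
  {x | ∃ U : Set X, IsOpen U ∧ x ∈ U ∧ ∃ n : ℕ, ∀ y ∈ U,
    w y ≤ n ∨ ∃ β : Ordinal.{0}, ∃ _ : β < α, y ∈ weightOrderLE w β}
termination_by α

/-- The order `o_w(x)`: the least `α` such that `x` has order at most `α`, and `∞` if there is no
such `α`. -/
def weightOrder {X : Type*} [TopologicalSpace X] (w : X → ℕ∞) (x : X) : WithTop Ordinal.{0} :=
  sInf {o | ∃ α : Ordinal.{0}, o = α ∧ x ∈ weightOrderLE w α}

/-- The rank `r_w(x) = ω * o_w(x) + w(x)`, which is `∞` if the order of `x` is `∞`. -/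
def weightRankAt {X : Type*} [TopologicalSpace X] (w : X → ℕ∞) (x : X) : WithTop Ordinal.{0} :=
  (weightOrder w x).map (fun o => ω * o) + (w x).map (fun n : ℕ => (n : Ordinal.{0}))

/-- The rank `r(w)`, the supremum of the ranks of all points. -/
def weightRank {X : Type*} [TopologicalSpace X] (w : X → ℕ∞) : WithTop Ordinal.{0} :=
  ⨆ x, weightRankAt w x

end Weights

/-! ### Closed two-sided ideals of a C*-algebra -/

/-- A closed two-sided ideal. -/
structure ClosedIdeal (A : Type*) [NonUnitalCStarAlgebra A] extends Submodule ℂ A where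
  isClosed' : IsClosed carrier
  mul_mem_left' : ∀ (a : A) {x : A}, x ∈ carrier → a * x ∈ carrier
  mul_mem_right' : ∀ (a : A) {x : A}, x ∈ carrier → x * a ∈ carrier

namespace ClosedIdeal

variable {A : Type*} [NonUnitalCStarAlgebra A]

instance : SetLike (ClosedIdeal A) A where
  coe I := I.carrier
  coe_injective I J h := by
    obtain ⟨I, _, _, _⟩ := I
    obtain ⟨J, _, _, _⟩ := J
    have : I = J := SetLike.coe_injective h
    subst this
    rfl

/-- Closed ideals are ordered by inclusion. -/
instance : PartialOrder (ClosedIdeal A) := .ofSetLike (ClosedIdeal A) A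

instance (I : ClosedIdeal A) : IsClosed (I : Set A) := I.isClosed'

theorem mul_mem_left (I : ClosedIdeal A) (a : A) {x : A} (hx : x ∈ I) : a * x ∈ I :=
  I.mul_mem_left' a hx

theorem mul_mem_right (I : ClosedIdeal A) (a : A) {x : A} (hx : x ∈ I) : x * a ∈ I :=
  I.mul_mem_right' a hx

instance : NonUnitalSubringClass (ClosedIdeal A) A where
  add_mem {I} _ _ ha hb := I.add_mem' ha hb
  zero_mem I := I.zero_mem'
  neg_mem {I} _ ha := I.toSubmodule.neg_mem ha
  mul_mem {I} a _ _ hb := I.mul_mem_left a hb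

instance : SMulMemClass (ClosedIdeal A) ℂ A where
  smul_mem {I} c _ ha := I.smul_mem' c ha

/-- Continuous functions vanishing at `0` of a self-adjoint element of a closed ideal belong to
the ideal. -/
theorem cfcₙ_mem_of_isSelfAdjoint (I : ClosedIdeal A) {h : A} (hsa : IsSelfAdjoint h)
    (hI : h ∈ I) (f : ℝ → ℝ) : cfcₙ f h ∈ I := by
  let S : NonUnitalStarSubalgebra ℝ A :=
    { carrier := {y | y ∈ I ∧ star y ∈ I}
      add_mem' := fun ha hb => ⟨add_mem ha.1 hb.1, by rw [star_add]; exact add_mem ha.2 hb.2⟩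
      zero_mem' := ⟨zero_mem I, by rw [star_zero]; exact zero_mem I⟩
      mul_mem' := fun ha hb => ⟨mul_mem ha.1 hb.1, by rw [star_mul]; exact mul_mem hb.2 ha.2⟩
      smul_mem' := fun c x hx => by
        have e : ∀ y : A, c • y = (c : ℂ) • y := fun y => (Complex.coe_smul c y).symm
        refine ⟨by rw [e]; exact SMulMemClass.smul_mem _ hx.1, ?_⟩
        rw [star_smul, star_trivial, e]
        exact SMulMemClass.smul_mem _ hx.2
      star_mem' := fun hx => ⟨hx.2, by rw [star_star]; exact hx.1⟩ }
  have hS : IsClosed (S : Set A) :=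
    I.isClosed'.inter (I.isClosed'.preimage continuous_star)
  have hh : h ∈ S := ⟨hI, by rw [hsa.star_eq]; exact hI⟩
  exact (NonUnitalStarAlgebra.elemental.le_of_mem hS hh (cfcₙ_mem_elemental f h)).1

/-- Closed two-sided ideals of a C*-algebra are self-adjoint. -/
theorem star_mem' (I : ClosedIdeal A) {a : A} (ha : a ∈ I) : star a ∈ I := by
  have hsa : IsSelfAdjoint (star a * a) := IsSelfAdjoint.star_mul_self a
  suffices hcl : star a ∈ closure (I : Set A) by
    have hcl' := (IsClosed.closure_eq (s := (I : Set A)) I.isClosed') ▸ hcl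
    exact hcl'
  refine Metric.mem_closure_iff.2 fun ε hε => ?_
  set δ : ℝ := ε ^ 2 / 4 with hδ
  have hδ0 : 0 < δ := by positivity
  obtain ⟨g, hgdef⟩ : ∃ g : ℝ → ℝ, ∀ x, g x = min 1 (|x| / δ) := ⟨_, fun _ => rfl⟩
  have hg : Continuous g := by
    rw [funext hgdef]
    fun_prop
  have hg0 : g 0 = 0 := by simp [hgdef]
  set h := star a * a with hh
  set k := cfcₙ g h with hk
  have hkI : k ∈ I := I.cfcₙ_mem_of_isSelfAdjoint hsa (I.mul_mem_left _ ha) g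
  have hks : star k = k := (cfcₙ_predicate g h : IsSelfAdjoint _).star_eq
  refine ⟨k * star a, I.mul_mem_right _ hkI, ?_⟩
  have key : (star a - k * star a) * star (star a - k * star a)
      = cfcₙ (fun x : ℝ => x - g x * x - (x * g x - g x * (x * g x))) h := by
    have h1 : cfcₙ (fun x : ℝ => x) h = h := cfcₙ_id' ℝ h
    have c0 : Continuous fun x : ℝ => x := continuous_id
    have c1 : Continuous fun x : ℝ => g x * x := hg.mul c0
    have c2 : Continuous fun x : ℝ => x * g x := c0.mul hg
    have c3 : Continuous fun x : ℝ => g x * (x * g x) := hg.mul c2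
    rw [cfcₙ_sub (fun x : ℝ => x - g x * x) (fun x : ℝ => x * g x - g x * (x * g x)) h
        (c0.sub c1).continuousOn (by simp) (c2.sub c3).continuousOn (by simp),
      cfcₙ_sub (fun x : ℝ => x) (fun x : ℝ => g x * x) h
        c0.continuousOn rfl c1.continuousOn (by simp),
      cfcₙ_sub (fun x : ℝ => x * g x) (fun x : ℝ => g x * (x * g x)) h
        c2.continuousOn (by simp) c3.continuousOn (by simp),
      cfcₙ_mul g (fun x : ℝ => x) h hg.continuousOn hg0 c0.continuousOn rfl,
      cfcₙ_mul g (fun x : ℝ => x * g x) h hg.continuousOn hg0 c2.continuousOn (by simp),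
      cfcₙ_mul (fun x : ℝ => x) g h c0.continuousOn rfl hg.continuousOn hg0, h1, ← hk]
    simp only [star_sub, star_mul, star_star, hks, sub_mul, mul_sub, mul_assoc, hh]
  have hb : ‖(star a - k * star a) * star (star a - k * star a)‖ ≤ δ := by
    rw [key]
    refine norm_cfcₙ_le fun x _ => ?_
    have e : x - g x * x - (x * g x - g x * (x * g x)) = x * (1 - g x) ^ 2 := by ring
    rw [e, Real.norm_eq_abs, abs_mul, abs_of_nonneg (sq_nonneg (1 - g x))]
    by_cases hx : |x| ≤ δ
    · have h1 : 0 ≤ g x := hgdef x ▸ le_min zero_le_one (by positivity)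
      have h2 : g x ≤ 1 := hgdef x ▸ min_le_left _ _
      have h3 : (1 - g x) ^ 2 ≤ 1 := by nlinarith
      nlinarith [abs_nonneg x, sq_nonneg (1 - g x)]
    · have h1 : g x = 1 := (hgdef x).trans <| min_eq_left (by rw [le_div_iff₀ hδ0]; linarith)
      simp [h1, hδ0.le]
  rw [CStarRing.norm_self_mul_star] at hb
  rw [dist_eq_norm]
  nlinarith [norm_nonneg (star a - k * star a)]

instance : StarMemClass (ClosedIdeal A) A where
  star_mem {I} _ ha := I.star_mem' ha

/-- The closed ideal generated by a set. -/
def span (S : Set A) : ClosedIdeal A where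
  carrier := {x | ∀ I : ClosedIdeal A, S ⊆ (I : Set A) → x ∈ I}
  add_mem' ha hb I hI := add_mem (ha I hI) (hb I hI)
  zero_mem' I _ := zero_mem I
  smul_mem' c _ hx I hI := SMulMemClass.smul_mem c (hx I hI)
  isClosed' := by
    simp only [Set.ofPred_forall]
    exact isClosed_iInter fun I => isClosed_iInter fun _ => I.isClosed'
  mul_mem_left' a _ hx I hI := I.mul_mem_left a (hx I hI)
  mul_mem_right' a _ hx I hI := I.mul_mem_right a (hx I hI)

theorem subset_span (S : Set A) : S ⊆ (span S : Set A) := fun _ hx _ hI => hI hx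

theorem span_le {S : Set A} {I : ClosedIdeal A} : span S ≤ I ↔ S ⊆ (I : Set A) :=
  ⟨fun h => (subset_span S).trans h, fun h _ hx => hx I h⟩

/-- The intersection of two closed ideals. -/
def inter (I J : ClosedIdeal A) : ClosedIdeal A where
  carrier := {x | x ∈ I ∧ x ∈ J}
  add_mem' ha hb := ⟨add_mem ha.1 hb.1, add_mem ha.2 hb.2⟩
  zero_mem' := ⟨zero_mem I, zero_mem J⟩
  smul_mem' c _ hx := ⟨SMulMemClass.smul_mem c hx.1, SMulMemClass.smul_mem c hx.2⟩
  isClosed' := I.isClosed'.inter J.isClosed'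
  mul_mem_left' a _ hx := ⟨I.mul_mem_left a hx.1, J.mul_mem_left a hx.2⟩
  mul_mem_right' a _ hx := ⟨I.mul_mem_right a hx.1, J.mul_mem_right a hx.2⟩

end ClosedIdeal

/-! ### Irreducible representations and the primitive spectrum -/

/-- A nonzero representation of `A` on a Hilbert space whose only closed invariant subspaces are
the trivial ones. The Hilbert space lives in the universe of `A`, which is no restriction up to
unitary equivalence. -/
structure IrrRep (A : Type u) [NonUnitalCStarAlgebra A] where
  H : Type u
  [normed : NormedAddCommGroup H]
  [inner : InnerProductSpace ℂ H]
  [complete : CompleteSpace H]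
  toHom : A →⋆ₙₐ[ℂ] (H →L[ℂ] H)
  ne_zero : ∃ a, toHom a ≠ 0
  irreducible : ∀ K : Submodule ℂ H, IsClosed (K : Set H) →
    (∀ a, ∀ ξ ∈ K, toHom a ξ ∈ K) → K = ⊥ ∨ K = ⊤

attribute [instance] IrrRep.normed IrrRep.inner IrrRep.complete

namespace IrrRep

variable {A : Type u} [NonUnitalCStarAlgebra A]

/-- The kernel of an irreducible representation. -/
def ker (π : IrrRep A) : ClosedIdeal A where
  carrier := {a | π.toHom a = 0}
  add_mem' ha hb := by
    simp only [Set.mem_ofPred_eq] at *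
    rw [map_add, ha, hb, add_zero]
  zero_mem' := map_zero _
  smul_mem' c _ ha := by
    simp only [Set.mem_ofPred_eq] at *
    rw [map_smul, ha, smul_zero]
  isClosed' := isClosed_eq
    (AddMonoidHomClass.continuous_of_bound π.toHom 1 fun a => by
      simpa only [one_mul] using NonUnitalStarAlgHom.norm_apply_le π.toHom a) continuous_const
  mul_mem_left' a _ ha := by
    simp only [Set.mem_ofPred_eq] at *
    rw [map_mul, ha, mul_zero]
  mul_mem_right' a _ ha := by
    simp only [Set.mem_ofPred_eq] at *
    rw [map_mul, ha, zero_mul]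

theorem mem_ker {π : IrrRep A} {a : A} : a ∈ π.ker ↔ π.toHom a = 0 := Iff.rfl

/-- The rank of `π(a)`, which is `∞` if the range of `π(a)` is infinite-dimensional. -/
def rankOf (π : IrrRep A) (a : A) : ℕ∞ :=
  Cardinal.toENat (LinearMap.rank (π.toHom a : π.H →ₗ[ℂ] π.H))

/-- A vector killed by an ideal on which the representation does not vanish is zero. -/
theorem eq_zero_of_forall_mem {π : IrrRep A} {I : ClosedIdeal A} (hI : ¬ I ≤ π.ker) {ξ : π.H}
    (hξ : ∀ x ∈ I, π.toHom x ξ = 0) : ξ = 0 := by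
  let K : Submodule ℂ π.H :=
    { carrier := {η | ∀ x ∈ I, π.toHom x η = 0}
      add_mem' := fun ha hb x hx => by rw [map_add, ha x hx, hb x hx, add_zero]
      zero_mem' := fun x _ => map_zero _
      smul_mem' := fun c η h x hx => by rw [map_smul, h x hx, smul_zero] }
  have hK : IsClosed (K : Set π.H) := by
    change IsClosed {η : π.H | ∀ x ∈ I, π.toHom x η = 0}
    simp only [Set.ofPred_forall]
    exact isClosed_iInter fun x => isClosed_iInter fun _ =>
      isClosed_eq (π.toHom x).continuous continuous_const
  have hinv : ∀ a, ∀ η ∈ K, π.toHom a η ∈ K := fun a η h x hx => by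
    have := h (x * a) (I.mul_mem_right a hx)
    rwa [map_mul] at this
  rcases π.irreducible K hK hinv with h | h
  · have : ξ ∈ K := hξ
    rwa [h, Submodule.mem_bot] at this
  · exfalso
    refine hI fun x hx => ?_
    rw [mem_ker]
    ext η
    have : η ∈ K := h ▸ Submodule.mem_top
    exact this x hx

/-- Kernels of irreducible representations are prime. -/
theorem le_ker_or_le_ker {π : IrrRep A} {I J : ClosedIdeal A} (h : I.inter J ≤ π.ker) :
    I ≤ π.ker ∨ J ≤ π.ker := by
  by_contra! hc
  refine hc.2 fun y hy => ?_
  rw [mem_ker]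
  ext η
  refine eq_zero_of_forall_mem hc.1 fun x hx => ?_
  have : x * y ∈ π.ker := h ⟨I.mul_mem_right y hx, J.mul_mem_left x hy⟩
  rw [mem_ker, map_mul] at this
  exact congrArg (fun T => T η) this

end IrrRep

/-- The primitive spectrum: the set of kernels of irreducible representations. -/
def Prim (A : Type u) [NonUnitalCStarAlgebra A] : Type u :=
  {t : ClosedIdeal A // ∃ π : IrrRep A, π.ker = t}

/-- The point of the primitive spectrum given by an irreducible representation. -/
def IrrRep.toPrim {A : Type u} [NonUnitalCStarAlgebra A] (π : IrrRep A) : Prim A :=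
  ⟨π.ker, π, rfl⟩

/-- The set of primitive ideals that contain `I`. -/
def hull {A : Type u} [NonUnitalCStarAlgebra A] (I : ClosedIdeal A) : Set (Prim A) :=
  {t | I ≤ t.1}

/-- The Jacobson topology: the closed sets are exactly the hulls of the closed ideals. -/
instance {A : Type u} [NonUnitalCStarAlgebra A] : TopologicalSpace (Prim A) :=
  TopologicalSpace.ofClosed {C | ∃ I : ClosedIdeal A, hull I = C}
    ⟨ClosedIdeal.span Set.univ, by
      refine Set.eq_empty_of_forall_notMem fun t ht => ?_
      obtain ⟨_, π, rfl⟩ := t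
      obtain ⟨a, ha⟩ := π.ne_zero
      exact ha (ht (ClosedIdeal.subset_span _ (Set.mem_univ a)))⟩
    (by
      intro 𝒞 h𝒞
      refine ⟨ClosedIdeal.span {x | ∃ I : ClosedIdeal A, hull I ∈ 𝒞 ∧ x ∈ I}, ?_⟩
      ext t
      simp only [hull, Set.mem_ofPred_eq, Set.mem_sInter, ClosedIdeal.span_le]
      constructor
      · intro h C hC
        obtain ⟨I, rfl⟩ := h𝒞 hC
        exact fun x hx => h ⟨I, hC, hx⟩
      · rintro h x ⟨I, hI, hx⟩
        exact h _ hI hx)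
    (by
      rintro _ ⟨I, rfl⟩ _ ⟨J, rfl⟩
      refine ⟨I.inter J, ?_⟩
      ext t
      obtain ⟨_, π, rfl⟩ := t
      constructor
      · exact fun h => IrrRep.le_ker_or_le_ker h
      · rintro (h | h)
        · exact fun x hx => h hx.1
        · exact fun x hx => h hx.2)

section Ranks

variable {A : Type u} [NonUnitalCStarAlgebra A]

/-- The function `w_a` on the primitive spectrum, `Ker π ↦ rank π(a)`. This rank depends only on
the kernel, so that the supremum is over a set with a single element. -/
def pedersenFunction (a : A) (t : Prim A) : ℕ∞ :=
  ⨆ (π : IrrRep A) (_ : π.toPrim = t), π.rankOf a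

/-- The Pedersen rank of an element. -/
def pedersenRank (a : A) : WithTop Ordinal.{0} :=
  weightRank (pedersenFunction a)

variable (A) in
/-- A local section `(b, U)`: an open set `U` of primitive ideals and `b` in `A` such that
`π(b) ≠ 0` whenever `Ker π` is in `U`. -/
structure LocalSection where
  b : A
  U : Set (Prim A)
  isOpen : IsOpen U
  ne_zero : ∀ π : IrrRep A, π.toPrim ∈ U → π.toHom b ≠ 0

/-- The Fell rank of a local section `(b, U)`: the rank of the function `Ker π ↦ rank π(b)` on the
space `U`. -/
def LocalSection.fellRank (s : LocalSection A) : WithTop Ordinal.{0} :=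
  weightRank (fun t : s.U => pedersenFunction s.b t)

/-- The Fell rank of an irreducible representation: the least Fell rank of the local sections
around it. -/
def IrrRep.fellRank (π : IrrRep A) : WithTop Ordinal.{0} :=
  sInf {r | ∃ s : LocalSection A, π.toPrim ∈ s.U ∧ s.fellRank = r}

variable (A) in
/-- The Fell rank of a C*-algebra: the supremum of the Fell ranks of its irreducible
representations. -/
def algebraFellRank : WithTop Ordinal.{0} :=
  ⨆ π : IrrRep A, π.fellRank

variable (A) in
/-- The Fell ideal of rank `α`: the closed ideal generated by the elements of Pedersen rank at
most `α`. -/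
def fellIdeal (α : Ordinal.{0}) : ClosedIdeal A :=
  ClosedIdeal.span {a | pedersenRank a ≤ α}

end Ranks

end

/-!
The heart of the matter is that an irreducible representation `π` has Fell rank at most `α` if and
only if `π(a) ≠ 0` for some `a` of Pedersen rank at most `α` (`IrrRep.fellRank_le_iff`). Such an
element is a local section around `π` over the open set where it does not vanish. Conversely, let
`(b, U)` be a local section around `π` of Fell rank at most `α`, and let `I` be the closed ideal
with `U = {t | ¬ I ≤ t}`. There is `x ∈ I` with `π(x b) ≠ 0`. The function of `x b` vanishes off
`U` and is at most that of `b` on `U`, and this suffices for its rank to be at most `α`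
(`weightRank_le_of_dominated`): the points outside `U`, where the function is zero, do not have
larger order than those of `U`. Since the Fell ideal is generated by the elements of Pedersen rank
at most `α`, the description of its hull follows.

For the maximality statement, irreducible representations of a closed ideal `I` are extended to
the algebra, and those of the algebra that do not vanish on `I` are restricted to `I`. The induced
maps between `Prim I` and the open subset of `Prim A` where `I` is not contained in the kernel
are continuous, hence the Pedersen rank of an element of `I` is the same in `I` as in `A`
(`pedersenRank_coe_le_iff`). So the Fell ideal has Fell rank at most `α`, and no irreducible
representation of the algebra that vanishes on the Fell ideal can be nonzero on an ideal of Fell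
rank at most `α`.

To conclude that the latter is contained in the former, one needs that a closed ideal `J` is the
intersection of the primitive ideals that contain it (`ClosedIdeal.le_of_forall_ker`). For
`h ≥ 0` outside `J`, the Hahn–Banach theorem gives a positive functional that vanishes on `J` but
not at `h`; by the Krein–Milman theorem it may be taken to be extreme among those of norm at most
`1`, and then its GNS representation is irreducible, vanishes on `J` and is nonzero at `h`.
-/

/-! ### Order and rank of functions on a topological space -/

section Weights

variable {X Y : Type*} [TopologicalSpace X] [TopologicalSpace Y]

theorem mem_weightOrderLE {w : X → ℕ∞} {α : Ordinal.{0}} {x : X} :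
    x ∈ weightOrderLE w α ↔ ∃ U : Set X, IsOpen U ∧ x ∈ U ∧ ∃ n : ℕ, ∀ y ∈ U,
      w y ≤ n ∨ ∃ β < α, y ∈ weightOrderLE w β := by
  rw [weightOrderLE]
  simp only [Set.mem_ofPred_eq, exists_prop]

theorem weightOrderLE_mono (w : X → ℕ∞) : Monotone (weightOrderLE w) := by
  intro α β h x hx
  obtain ⟨U, hU, hxU, n, hn⟩ := mem_weightOrderLE.1 hx
  refine mem_weightOrderLE.2 ⟨U, hU, hxU, n, fun y hy => (hn y hy).imp_right ?_⟩
  rintro ⟨γ, hγ, hyγ⟩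
  exact ⟨γ, hγ.trans_le h, hyγ⟩

/-- The order of a point can only go down when the function is pulled back along a continuous map
and made smaller. -/
theorem preimage_weightOrderLE_subset {f : Y → X} (hf : Continuous f) {v : Y → ℕ∞} {w : X → ℕ∞}
    (h : ∀ y, v y ≤ w (f y)) (α : Ordinal.{0}) :
    f ⁻¹' weightOrderLE w α ⊆ weightOrderLE v α := by
  induction α using WellFoundedLT.induction with
  | ind α ih =>
    intro y hy
    obtain ⟨U, hU, hyU, n, hn⟩ := mem_weightOrderLE.1 hy
    refine mem_weightOrderLE.2 ⟨f ⁻¹' U, hU.preimage hf, hyU, n, fun z hz => ?_⟩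
    refine (hn (f z) hz).imp (h z).trans ?_
    rintro ⟨β, hβ, hzβ⟩
    exact ⟨β, hβ, ih β hβ hzβ⟩

/-- The order of a point with respect to `w` may be computed in an open subspace. -/
theorem image_weightOrderLE_subset {U : Set X} (hU : IsOpen U) (w : X → ℕ∞) (α : Ordinal.{0}) :
    Subtype.val '' weightOrderLE (fun x : U => w x) α ⊆ weightOrderLE w α := by
  induction α using WellFoundedLT.induction with
  | ind α ih =>
    rintro _ ⟨x, hx, rfl⟩
    obtain ⟨V, hV, hxV, n, hn⟩ := mem_weightOrderLE.1 hx
    refine mem_weightOrderLE.2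
      ⟨Subtype.val '' V, hU.isOpenMap_subtype_val V hV, ⟨x, hxV, rfl⟩, n, ?_⟩
    rintro _ ⟨z, hz, rfl⟩
    refine (hn z hz).imp_right ?_
    rintro ⟨β, hβ, hzβ⟩
    exact ⟨β, hβ, ih β hβ ⟨z, hzβ, rfl⟩⟩

theorem weightOrder_le_iff {w : X → ℕ∞} {x : X} {α : Ordinal.{0}} :
    weightOrder w x ≤ α ↔ x ∈ weightOrderLE w α := by
  constructor
  · intro h
    have hne : {o : WithTop Ordinal.{0} |
        ∃ α : Ordinal.{0}, o = α ∧ x ∈ weightOrderLE w α}.Nonempty := by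
      by_contra hc
      rw [Set.not_nonempty_iff_eq_empty] at hc
      rw [weightOrder, hc, sInf_empty] at h
      exact (WithTop.coe_lt_top α).not_ge h
    obtain ⟨β, hβ, hx⟩ := csInf_mem hne
    have hβ' : weightOrder w x = β := hβ
    rw [hβ', WithTop.coe_le_coe] at h
    exact weightOrderLE_mono w h hx
  · exact fun h => sInf_le ⟨α, rfl, h⟩

/-- A point has rank at most `α` if and only if its order is at most some `β` and its value is
some natural number `n` with `ω * β + n ≤ α`. -/
theorem weightRankAt_le_iff {w : X → ℕ∞} {x : X} {α : Ordinal.{0}} :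
    weightRankAt w x ≤ α ↔ ∃ (β : Ordinal.{0}) (n : ℕ),
      x ∈ weightOrderLE w β ∧ w x = n ∧ ω * β + n ≤ α := by
  constructor
  · intro h
    have h' := h
    rw [weightRankAt] at h'
    have ho : weightOrder w x ≠ ⊤ := by
      intro ho
      rw [ho, WithTop.map_top, WithTop.top_add] at h'
      exact (WithTop.coe_lt_top α).not_ge h'
    obtain ⟨β, hβ⟩ := WithTop.ne_top_iff_exists.1 ho
    have hw : w x ≠ ⊤ := by
      intro hw
      rw [hw, ENat.map_top, WithTop.add_top] at h'
      exact (WithTop.coe_lt_top α).not_ge h'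
    obtain ⟨n, hn⟩ := ENat.ne_top_iff_exists.1 hw
    rw [← hβ, ← hn, WithTop.map_coe, ENat.map_natCast] at h'
    exact ⟨β, n, weightOrder_le_iff.1 hβ.ge, hn.symm, by exact_mod_cast h'⟩
  · rintro ⟨β, n, hx, hn, h⟩
    have ho : weightOrder w x ≤ β := weightOrder_le_iff.2 hx
    obtain ⟨γ, hγ⟩ := WithTop.ne_top_iff_exists.1 (ho.trans_lt (WithTop.coe_lt_top β)).ne
    rw [← hγ, WithTop.coe_le_coe] at ho
    have : weightRankAt w x = ((ω * γ + n : Ordinal.{0}) : WithTop Ordinal.{0}) := by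
      rw [weightRankAt, ← hγ, hn]
      rfl
    rw [this, WithTop.coe_le_coe]
    exact le_trans (by gcongr) h

theorem weightRank_le_iff {w : X → ℕ∞} {α : Ordinal.{0}} :
    weightRank w ≤ α ↔ ∀ x, ∃ (β : Ordinal.{0}) (n : ℕ),
      x ∈ weightOrderLE w β ∧ w x = n ∧ ω * β + n ≤ α := by
  rw [weightRank, iSup_le_iff]
  exact forall_congr' fun x => weightRankAt_le_iff

/-- Let `v` vanish off an open set `U` and be dominated on `U` by the pullback of a function `w` of
rank at most `α`. Then `v` has rank at most `α`. Write `α = ω * γ + m`. A point of `U` has order at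
most `γ` with respect to `w`, and where the order is exactly `γ` the value is at most `m`. So `m`
bounds `v` away from the points of order less than `γ`, and the points outside `U` have order at
most `γ` as well. -/
theorem weightRank_le_of_dominated {U : Set X} (hU : IsOpen U) {f : U → Y} (hf : Continuous f)
    {v : X → ℕ∞} {w : Y → ℕ∞} (hvU : ∀ x ∉ U, v x = 0) (hv : ∀ x : U, v x ≤ w (f x))
    {α : Ordinal.{0}} (hw : weightRank w ≤ α) : weightRank v ≤ α := by
  rw [weightRank_le_iff] at hw ⊢
  have hmove : ∀ (x : U) (β : Ordinal.{0}), f x ∈ weightOrderLE w β → (x : X) ∈ weightOrderLE v β :=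
    fun x β hx => image_weightOrderLE_subset hU v β
      ⟨x, preimage_weightOrderLE_subset hf (v := fun x : U => v x) hv β hx, rfl⟩
  intro x
  by_cases hx : x ∈ U
  · obtain ⟨β, n, hβ, hn, hle⟩ := hw (f ⟨x, hx⟩)
    have hvn : v x ≤ n := hn ▸ hv ⟨x, hx⟩
    obtain ⟨k, hk⟩ := ENat.ne_top_iff_exists.1 (hvn.trans_lt (ENat.natCast_lt_top n)).ne
    rw [← hk, Nat.cast_le] at hvn
    refine ⟨β, k, hmove ⟨x, hx⟩ β hβ, hk.symm, le_trans ?_ hle⟩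
    gcongr
  · -- with `α = ω * (α / ω) + m`, the whole space witnesses that `x` has order at most `α / ω`
    have hω : (ω : Ordinal.{0}) ≠ 0 := Ordinal.omega0_ne_zero
    obtain ⟨m, hm⟩ := Ordinal.lt_omega0.1 (Ordinal.mod_lt α hω)
    refine ⟨α / ω, 0, mem_weightOrderLE.2 ⟨Set.univ, isOpen_univ, Set.mem_univ x, m, ?_⟩,
      by simpa using hvU x hx, by simpa using Ordinal.mul_div_le α ω⟩
    intro y _
    by_cases hy : y ∈ U
    · obtain ⟨β, n, hβ, hn, hle⟩ := hw (f ⟨y, hy⟩)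
      have hβα : β ≤ α / ω := (Ordinal.mul_le_iff_le_div hω).1 ((le_self_add).trans hle)
      rcases hβα.lt_or_eq with hlt | rfl
      · exact Or.inr ⟨β, hlt, hmove ⟨y, hy⟩ β hβ⟩
      · left
        refine (hv ⟨y, hy⟩).trans ?_
        rw [hn]
        have hle' : ω * (α / ω) + (n : Ordinal.{0}) ≤ ω * (α / ω) + m := by
          rwa [← hm, Ordinal.div_add_mod]
        exact_mod_cast (add_le_add_iff_left _).1 hle'
    · exact Or.inl (by simp [hvU y hy])

end Weights

/-! ### The primitive spectrum -/

section PrimitiveSpectrum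

variable {A : Type u} [NonUnitalCStarAlgebra A]

theorem Prim.isClosed_iff {C : Set (Prim A)} :
    IsClosed C ↔ ∃ I : ClosedIdeal A, hull I = C := by
  rw [← isOpen_compl_iff]
  change Cᶜᶜ ∈ {C : Set (Prim A) | ∃ I : ClosedIdeal A, hull I = C} ↔ _
  rw [compl_compl]
  rfl

theorem isClosed_hull (I : ClosedIdeal A) : IsClosed (hull I) :=
  Prim.isClosed_iff.2 ⟨I, rfl⟩

theorem continuous_prim_iff {X : Type*} [TopologicalSpace X] {f : X → Prim A} :
    Continuous f ↔ ∀ I : ClosedIdeal A, IsClosed {x | I ≤ (f x).1} := by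
  rw [continuous_iff_isClosed]
  refine ⟨fun h I => h _ (isClosed_hull I), fun h C hC => ?_⟩
  obtain ⟨I, rfl⟩ := Prim.isClosed_iff.1 hC
  exact h I

/-- Every open set of primitive ideals consists of the primitive ideals that do not contain some
closed ideal. -/
theorem Prim.exists_eq_compl_hull {U : Set (Prim A)} (hU : IsOpen U) :
    ∃ I : ClosedIdeal A, U = (hull I)ᶜ := by
  obtain ⟨I, hI⟩ := Prim.isClosed_iff.1 hU.isClosed_compl
  exact ⟨I, by rw [hI, compl_compl]⟩

theorem isOpen_setOf_notMem (a : A) : IsOpen {t : Prim A | a ∉ t.1} := by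
  have h : {t : Prim A | a ∉ t.1} = (hull (ClosedIdeal.span {a}))ᶜ := by
    ext t
    simp [hull, ClosedIdeal.span_le]
  rw [h]
  exact (isClosed_hull _).isOpen_compl

theorem IrrRep.rankOf_le_pedersenFunction (π : IrrRep A) (a : A) :
    π.rankOf a ≤ pedersenFunction a π.toPrim :=
  le_iSup₂_of_le π rfl le_rfl

theorem pedersenFunction_le_iff {a : A} {t : Prim A} {n : ℕ∞} :
    pedersenFunction a t ≤ n ↔ ∀ π : IrrRep A, π.toPrim = t → π.rankOf a ≤ n :=
  iSup₂_le_iff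

theorem IrrRep.rankOf_eq_zero {π : IrrRep A} {a : A} (h : π.toHom a = 0) : π.rankOf a = 0 := by
  rw [IrrRep.rankOf, h]
  simp

theorem IrrRep.rankOf_mul_le (π : IrrRep A) (a b : A) : π.rankOf (a * b) ≤ π.rankOf b := by
  rw [IrrRep.rankOf, IrrRep.rankOf, map_mul]
  exact OrderHomClass.mono Cardinal.toENat
    (LinearMap.rank_comp_le_right (π.toHom b : π.H →ₗ[ℂ] π.H) (π.toHom a : π.H →ₗ[ℂ] π.H))

end PrimitiveSpectrum

/-! ### Restriction to ideals and extension from ideals -/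

section RestrictExtend

theorem inner_map_left {B H : Type*} [NonUnitalCStarAlgebra B] [NormedAddCommGroup H]
    [InnerProductSpace ℂ H] [CompleteSpace H] (π : B →⋆ₙₐ[ℂ] (H →L[ℂ] H)) (x : B) (ξ η : H) :
    inner ℂ (π x ξ) η = inner ℂ ξ (π (star x) η) := by
  rw [map_star, ContinuousLinearMap.star_eq_adjoint, ContinuousLinearMap.adjoint_inner_right]

variable {A : Type u} [NonUnitalCStarAlgebra A]

namespace IrrRep

/-- In an irreducible representation, the orbit of a nonzero vector under an ideal on which the
representation does not vanish is dense. -/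
theorem dense_orbit {π : IrrRep A} {I : ClosedIdeal A} (hI : ¬ I ≤ π.ker) {ξ : π.H}
    (hξ : ξ ≠ 0) : Dense ((fun x => π.toHom x ξ) '' (I : Set A)) := by
  let ev : A →ₗ[ℂ] π.H :=
    { toFun := fun x => π.toHom x ξ
      map_add' := fun x y => by rw [map_add]; rfl
      map_smul' := fun c x => by rw [map_smul]; rfl }
  have hcoe : ((I.toSubmodule.map ev : Submodule ℂ π.H) : Set π.H)
      = (fun x => π.toHom x ξ) '' (I : Set A) := Submodule.map_coe _ _
  have hinv : ∀ a, ∀ η ∈ (I.toSubmodule.map ev).topologicalClosure,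
      π.toHom a η ∈ (I.toSubmodule.map ev).topologicalClosure := by
    intro a η hη
    refine map_mem_closure (π.toHom a).continuous hη ?_
    rintro _ ⟨x, hx, rfl⟩
    refine ⟨a * x, I.mul_mem_left a hx, ?_⟩
    change π.toHom (a * x) ξ = π.toHom a (π.toHom x ξ)
    rw [map_mul]
    rfl
  rcases π.irreducible _ (Submodule.isClosed_topologicalClosure _) hinv with h | h
  · refine absurd (eq_zero_of_forall_mem hI fun x hx => ?_) hξ
    have : π.toHom x ξ ∈ (I.toSubmodule.map ev).topologicalClosure :=
      Submodule.le_topologicalClosure _ ⟨x, hx, rfl⟩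
    rwa [h, Submodule.mem_bot] at this
  · rw [← hcoe]
    exact Submodule.dense_iff_topologicalClosure_eq_top.2 h

/-- The restriction of an irreducible representation to an ideal on which it does not vanish. -/
noncomputable def restrict (π : IrrRep A) (I : ClosedIdeal A) (hI : ¬ I ≤ π.ker) : IrrRep I where
  H := π.H
  toHom := π.toHom.comp (NonUnitalStarSubalgebraClass.subtype I)
  ne_zero := by
    by_contra! h
    exact hI fun x hx => h ⟨x, hx⟩
  irreducible K hK hinv := by
    refine or_iff_not_imp_left.2 fun hne => ?_
    obtain ⟨ξ, hξ, hξ0⟩ := Submodule.exists_mem_ne_zero_of_ne_bot hne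
    have hsub : (fun x => π.toHom x ξ) '' (I : Set A) ⊆ K := by
      rintro _ ⟨x, hx, rfl⟩
      exact hinv ⟨x, hx⟩ ξ hξ
    have := (dense_orbit hI hξ0).mono hsub
    rw [← SetLike.coe_set_eq, Submodule.top_coe, ← hK.closure_eq, this.closure_eq]

theorem denseRange_orbit (π : IrrRep A) {ξ : π.H} (hξ : ξ ≠ 0) :
    DenseRange fun x => π.toHom x ξ := by
  have hI : ¬ ClosedIdeal.span (Set.univ : Set A) ≤ π.ker := fun h => by
    obtain ⟨a, ha⟩ := π.ne_zero
    exact ha (h (ClosedIdeal.subset_span _ (Set.mem_univ a)))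
  exact (dense_orbit hI hξ).mono (Set.image_subset_range _ _)

theorem exists_vector_ne_zero (π : IrrRep A) : ∃ ξ : π.H, ξ ≠ 0 := by
  obtain ⟨a, ha⟩ := π.ne_zero
  by_contra! h
  exact ha (ContinuousLinearMap.ext fun ξ => h _)

/-- Two operators agree if they agree on all vectors of the form `π(x) ξ`. -/
theorem operator_ext (π : IrrRep A) {S T : π.H →L[ℂ] π.H}
    (h : ∀ x ξ, S (π.toHom x ξ) = T (π.toHom x ξ)) : S = T := by
  obtain ⟨ξ, hξ⟩ := π.exists_vector_ne_zero
  ext η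
  exact (π.denseRange_orbit hξ).induction_on η (isClosed_eq S.continuous T.continuous)
    fun x => h x ξ

end IrrRep

/-- Left multiplication by an element of the algebra, as a linear map of a closed ideal. -/
def ClosedIdeal.mulLeft (I : ClosedIdeal A) (a : A) : I →ₗ[ℂ] I where
  toFun x := ⟨a * x, I.mul_mem_left a x.2⟩
  map_add' x y := Subtype.ext (mul_add a (x : A) y)
  map_smul' c x := Subtype.ext (mul_smul_comm c a (x : A))

namespace IrrRep

variable {I : ClosedIdeal A}

/-- The estimate that extends a representation `σ` of an ideal: since `a x` is the limit of
`(a e) x` for `e` in an approximate unit of the ideal, and `‖a e‖ ≤ ‖a‖`, left multiplication by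
`a` is bounded by `‖a‖` on vectors `σ(x) ξ`. -/
theorem norm_mulLeft_apply_le (σ : IrrRep I) (a : A) (x : I) (ξ : σ.H) :
    ‖σ.toHom (I.mulLeft a x) ξ‖ ≤ ‖a‖ * ‖σ.toHom x ξ‖ := by
  let _ : PartialOrder I := CStarAlgebra.spectralOrder I
  have _ : StarOrderedRing I := CStarAlgebra.spectralOrderedRing I
  have hl := CStarAlgebra.increasingApproximateUnit I
  have hmul : Continuous (I.mulLeft a) :=
    Continuous.subtype_mk (continuous_const.mul continuous_subtype_val) _
  have hσ : Continuous fun y : I => σ.toHom y ξ :=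
    (AddMonoidHomClass.continuous_of_bound σ.toHom 1 fun a => by
      simpa only [one_mul] using NonUnitalStarAlgHom.norm_apply_le σ.toHom a).clm_apply
      continuous_const
  have hlim := ((hσ.comp hmul).norm.tendsto x).comp (hl.tendsto_mul_right x)
  refine le_of_tendsto hlim ?_
  filter_upwards [hl.eventually_norm] with e he
  have heq : I.mulLeft a (e * x) = I.mulLeft a e * x :=
    Subtype.ext (mul_assoc a (e : A) x).symm
  change ‖σ.toHom (I.mulLeft a (e * x)) ξ‖ ≤ _
  rw [heq, map_mul]
  refine ((σ.toHom (I.mulLeft a e)).le_opNorm _).trans ?_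
  refine mul_le_mul_of_nonneg_right ?_ (norm_nonneg _)
  refine (NonUnitalStarAlgHom.norm_apply_le σ.toHom _).trans ?_
  calc ‖I.mulLeft a e‖ = ‖a * (e : A)‖ := rfl
    _ ≤ ‖a‖ * ‖(e : A)‖ := norm_mul_le _ _
    _ ≤ ‖a‖ * 1 := by gcongr; exact he
    _ = ‖a‖ := mul_one _

theorem exists_extension (σ : IrrRep I) (a : A) :
    ∃ T : σ.H →L[ℂ] σ.H, ∀ x ξ, T (σ.toHom x ξ) = σ.toHom (I.mulLeft a x) ξ := by
  obtain ⟨ξ, hξ⟩ := σ.exists_vector_ne_zero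
  let ev : I →ₗ[ℂ] σ.H :=
    { toFun := fun x => σ.toHom x ξ
      map_add' := fun x y => by rw [map_add]; rfl
      map_smul' := fun c x => by rw [map_smul]; rfl }
  have hev : DenseRange ev := σ.denseRange_orbit hξ
  refine ⟨(ev ∘ₗ I.mulLeft a).extendOfNorm ev, fun x η => ?_⟩
  refine hev.induction_on (p := fun η => (ev ∘ₗ I.mulLeft a).extendOfNorm ev (σ.toHom x η)
    = σ.toHom (I.mulLeft a x) η) η (isClosed_eq (by fun_prop) (by fun_prop)) fun y => ?_
  have h := LinearMap.extendOfNorm_eq (f := ev ∘ₗ I.mulLeft a) (e := ev) hev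
    ⟨‖a‖, fun x => σ.norm_mulLeft_apply_le a x ξ⟩ (x * y)
  have h1 : ev (x * y) = σ.toHom x (ev y) := by
    change σ.toHom (x * y) ξ = _
    rw [map_mul]
    rfl
  have h2 : I.mulLeft a (x * y) = I.mulLeft a x * y := Subtype.ext (mul_assoc a (x : A) y).symm
  rw [h1] at h
  rw [h]
  change σ.toHom (I.mulLeft a (x * y)) ξ = _
  rw [h2, map_mul]
  rfl

/-- The operator by which an element `a` of the algebra acts on the space of an irreducible
representation `σ` of an ideal; it is determined by `σ(x) ξ ↦ σ(a x) ξ`. -/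
noncomputable def extendOp (σ : IrrRep I) (a : A) : σ.H →L[ℂ] σ.H := (σ.exists_extension a).choose

theorem extendOp_apply (σ : IrrRep I) (a : A) (x : I) (ξ : σ.H) :
    σ.extendOp a (σ.toHom x ξ) = σ.toHom (I.mulLeft a x) ξ :=
  (σ.exists_extension a).choose_spec x ξ

theorem extendOp_coe (σ : IrrRep I) (x : I) : σ.extendOp (x : A) = σ.toHom x := by
  refine σ.operator_ext fun y ξ => ?_
  rw [extendOp_apply, show I.mulLeft x y = x * y from rfl, map_mul]
  rfl

/-- The extension of an irreducible representation of an ideal to the whole algebra. -/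
noncomputable def extend (σ : IrrRep I) : IrrRep A where
  H := σ.H
  toHom :=
    { toFun := σ.extendOp
      map_smul' := fun c a => σ.operator_ext fun x ξ => by
        have : I.mulLeft (c • a) x = c • I.mulLeft a x :=
          Subtype.ext (smul_mul_assoc c a (x : A))
        rw [smul_apply, extendOp_apply, extendOp_apply, this, map_smul]
        rfl
      map_zero' := σ.operator_ext fun x ξ => by
        have : I.mulLeft 0 x = 0 := Subtype.ext (zero_mul (x : A))
        rw [extendOp_apply, this, map_zero]
        rfl
      map_add' := fun a b => σ.operator_ext fun x ξ => by
        have : I.mulLeft (a + b) x = I.mulLeft a x + I.mulLeft b x :=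
          Subtype.ext (add_mul a b (x : A))
        rw [add_apply, extendOp_apply, extendOp_apply, extendOp_apply, this,
          map_add]
        rfl
      map_mul' := fun a b => σ.operator_ext fun x ξ => by
        have : I.mulLeft (a * b) x = I.mulLeft a (I.mulLeft b x) :=
          Subtype.ext (mul_assoc a b (x : A))
        rw [mul_apply_eq_comp, extendOp_apply, extendOp_apply, extendOp_apply, this]
      map_star' := fun a => by
        rw [ContinuousLinearMap.star_eq_adjoint, ContinuousLinearMap.eq_adjoint_iff]
        obtain ⟨ξ, hξ⟩ := σ.exists_vector_ne_zero
        have hd := σ.denseRange_orbit hξ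
        intro η ζ
        refine hd.induction_on₂ (p := fun η ζ =>
          Inner.inner ℂ (σ.extendOp (star a) η) ζ = Inner.inner ℂ η (σ.extendOp a ζ))
          (isClosed_eq (by fun_prop) (by fun_prop)) (fun x y => ?_) η ζ
        have hxy : star (I.mulLeft (star a) x) * y = star x * I.mulLeft a y := Subtype.ext <| by
          change star (star a * (x : A)) * y = star (x : A) * (a * y)
          rw [star_mul, star_star, mul_assoc]
        rw [extendOp_apply, extendOp_apply, inner_map_left, inner_map_left, ← mul_apply_eq_comp,
          ← mul_apply_eq_comp, ← map_mul, ← map_mul, hxy] }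
  ne_zero := by
    obtain ⟨x, hx⟩ := σ.ne_zero
    exact ⟨x, (σ.extendOp_coe x).trans_ne hx⟩
  irreducible K hK hinv := σ.irreducible K hK fun x ξ hξ => by
    have : σ.extendOp x ξ ∈ K := hinv x ξ hξ
    rwa [extendOp_coe] at this

theorem extend_toHom_coe (σ : IrrRep I) (x : I) : σ.extend.toHom (x : A) = σ.toHom x :=
  σ.extendOp_coe x

theorem rankOf_extend (σ : IrrRep I) (x : I) : σ.extend.rankOf (x : A) = σ.rankOf x :=
  congrArg (fun T : σ.H →L[ℂ] σ.H => Cardinal.toENat (LinearMap.rank (T : σ.H →ₗ[ℂ] σ.H)))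
    (σ.extendOp_coe x)

theorem mem_ker_extend {σ : IrrRep I} {a : A} :
    a ∈ σ.extend.ker ↔ ∀ x : I, I.mulLeft a x ∈ σ.ker := by
  constructor
  · intro h x
    have h' : σ.extendOp a = 0 := h
    rw [mem_ker]
    ext ξ
    rw [← extendOp_apply, h']
    rfl
  · intro h
    refine σ.operator_ext fun x ξ => ?_
    change σ.extendOp a _ = _
    rw [extendOp_apply, mem_ker.1 (h x)]
    rfl

/-- A closed ideal `J` is in the kernel of the extension if and only if `I ∩ J` is in the kernel
of the given representation of `I`. -/
theorem le_ker_extend_iff {σ : IrrRep I} {J : ClosedIdeal A} :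
    J ≤ σ.extend.ker ↔ ∀ x : I, (x : A) ∈ J → x ∈ σ.ker := by
  constructor
  · intro h x hx
    rw [mem_ker, ← extend_toHom_coe]
    exact h hx
  · exact fun h a ha => mem_ker_extend.2 fun x => h _ (J.mul_mem_right _ ha)

theorem toPrim_extend_congr {σ τ : IrrRep I} (h : σ.toPrim = τ.toPrim) :
    σ.extend.toPrim = τ.extend.toPrim := by
  have hk : σ.ker = τ.ker := congrArg Subtype.val h
  refine Subtype.ext (SetLike.ext fun a => ?_)
  change a ∈ σ.extend.ker ↔ a ∈ τ.extend.ker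
  rw [mem_ker_extend, mem_ker_extend, hk]

end IrrRep

/-- The preimage of a closed ideal of the algebra in a closed ideal, as a closed ideal of the
latter. -/
def ClosedIdeal.comap (I J : ClosedIdeal A) : ClosedIdeal I where
  carrier := {x | (x : A) ∈ J}
  add_mem' ha hb := add_mem (S := ClosedIdeal A) ha hb
  zero_mem' := zero_mem J
  smul_mem' c _ hx := SMulMemClass.smul_mem (S := ClosedIdeal A) c hx
  isClosed' := J.isClosed'.preimage continuous_subtype_val
  mul_mem_left' a _ hx := J.mul_mem_left a hx
  mul_mem_right' a _ hx := J.mul_mem_right a hx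

/-- The map from the primitive spectrum of an ideal to that of the algebra, given by the extension
of representations. The kernel of the extension does not depend on the chosen representation. -/
noncomputable def extendPrim (I : ClosedIdeal A) (t : Prim I) : Prim A :=
  (t.2.choose).extend.toPrim

theorem extendPrim_toPrim {I : ClosedIdeal A} (σ : IrrRep I) :
    extendPrim I σ.toPrim = σ.extend.toPrim :=
  IrrRep.toPrim_extend_congr (Subtype.ext σ.toPrim.2.choose_spec)

theorem continuous_extendPrim (I : ClosedIdeal A) : Continuous (extendPrim I) := by
  refine continuous_prim_iff.2 fun J => ?_
  convert isClosed_hull (I.comap J) using 1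
  ext ⟨_, σ, rfl⟩
  change J ≤ (extendPrim I σ.toPrim).1 ↔ I.comap J ≤ σ.ker
  rw [extendPrim_toPrim]
  exact IrrRep.le_ker_extend_iff

/-- The map to the primitive spectrum of an ideal from the open set of all primitive ideals that
do not contain the ideal, given by the restriction of representations. -/
noncomputable def restrictPrim (I : ClosedIdeal A) (t : ((hull I)ᶜ : Set (Prim A))) : Prim I :=
  ⟨I.comap t.1.1, by
    obtain ⟨⟨_, π, rfl⟩, hπ⟩ := t
    exact ⟨π.restrict I hπ, rfl⟩⟩

theorem continuous_restrictPrim (I : ClosedIdeal A) : Continuous (restrictPrim I) := by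
  refine continuous_prim_iff.2 fun J => ?_
  convert (isClosed_hull (ClosedIdeal.span (Subtype.val '' (J : Set I)))).preimage
    continuous_subtype_val using 1
  ext t
  change J ≤ I.comap t.1.1 ↔ ClosedIdeal.span _ ≤ t.1.1
  rw [ClosedIdeal.span_le, Set.image_subset_iff]
  rfl

end RestrictExtend

/-! ### Pure functionals that vanish on a closed ideal -/

section Existence

open scoped ComplexOrder ComplexStarModule InnerProductSpace
open Filter

variable {A : Type u} [NonUnitalCStarAlgebra A] [PartialOrder A]

/-- The positive functionals of norm at most `1` that vanish on the ideal `J`, as a set of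
functions on `A`; positivity makes such a functional continuous, and its norm is the supremum of
its values on the nonnegative elements of norm less than `1`. -/
def quasiStates (J : ClosedIdeal A) : Set (A → ℂ) :=
  {f | f ∈ Set.range ((↑) : (A →ₗ[ℂ] ℂ) → A → ℂ) ∧ (∀ a, 0 ≤ a → 0 ≤ f a) ∧
    (∀ a, 0 ≤ a → ‖a‖ < 1 → (f a).re ≤ 1) ∧ ∀ j ∈ J, f j = 0}

theorem isClosed_quasiStates (J : ClosedIdeal A) : IsClosed (quasiStates J) := by
  have h1 : IsClosed {f : A → ℂ | ∀ a, 0 ≤ a → 0 ≤ f a} := by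
    simp only [Set.ofPred_forall]
    exact isClosed_iInter fun a => isClosed_iInter fun _ =>
      isClosed_le continuous_const (continuous_apply a)
  have h2 : IsClosed {f : A → ℂ | ∀ a, 0 ≤ a → ‖a‖ < 1 → (f a).re ≤ 1} := by
    simp only [Set.ofPred_forall]
    exact isClosed_iInter fun a => isClosed_iInter fun _ => isClosed_iInter fun _ =>
      isClosed_le (Complex.continuous_re.comp (continuous_apply a)) continuous_const
  have h3 : IsClosed {f : A → ℂ | ∀ j ∈ J, f j = 0} := by
    simp only [Set.ofPred_forall]
    exact isClosed_iInter fun a => isClosed_iInter fun _ =>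
      isClosed_eq (continuous_apply a) continuous_const
  exact (LinearMap.isClosed_range_coe A ℂ (RingHom.id ℂ)).inter (h1.inter (h2.inter h3))

theorem convex_quasiStates (J : ClosedIdeal A) : Convex ℝ (quasiStates J) := by
  rintro _ ⟨⟨φ, rfl⟩, hφ0, hφ1, hφJ⟩ _ ⟨⟨ψ, rfl⟩, hψ0, hψ1, hψJ⟩ s t hs ht hst
  refine ⟨⟨(s : ℂ) • φ + (t : ℂ) • ψ, ?_⟩, fun a ha => ?_, fun a ha han => ?_, fun j hj => ?_⟩
  · ext a
    simp
  · have h1 := hφ0 a ha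
    have h2 := hψ0 a ha
    simp only [Pi.add_apply, Pi.smul_apply]
    exact add_nonneg (smul_nonneg hs h1) (smul_nonneg ht h2)
  · have h1 := hφ1 a ha han
    have h2 := hψ1 a ha han
    simp only [Pi.add_apply, Pi.smul_apply, Complex.add_re, Complex.smul_re, smul_eq_mul]
    nlinarith
  · simp [hφJ j hj, hψJ j hj]

/-- Rescaling a positive functional that vanishes on `J` by a bound for its norm. -/
theorem inv_smul_mem_quasiStates {J : ClosedIdeal A} {φ : A →ₗ[ℂ] ℂ} (h0 : ∀ a, 0 ≤ a → 0 ≤ φ a)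
    (hJ : ∀ j ∈ J, φ j = 0) {c : ℝ} (hc : 0 < c)
    (h1 : ∀ a, 0 ≤ a → ‖a‖ < 1 → (φ a).re ≤ c) : (c⁻¹ • (φ : A → ℂ)) ∈ quasiStates J := by
  refine ⟨⟨((c⁻¹ : ℝ) : ℂ) • φ, ?_⟩, fun a ha => ?_, fun a ha han => ?_, fun j hj => ?_⟩
  · ext a
    simp
  · exact smul_nonneg (inv_nonneg.2 hc.le) (h0 a ha)
  · rw [Pi.smul_apply, Complex.smul_re, smul_eq_mul, inv_mul_le_one₀ hc]
    exact h1 a ha han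
  · simp [hJ j hj]

variable [StarOrderedRing A]

theorem exists_norm_le_of_mem_quasiStates (J : ClosedIdeal A) (x : A) :
    ∃ C : ℝ, ∀ f ∈ quasiStates J, ‖f x‖ ≤ C := by
  have hx : x ∈ Submodule.span ℂ ({x : A | 0 ≤ x} ∩ Metric.ball 0 1) := by
    rw [CStarAlgebra.span_nonneg_inter_unitBall]
    trivial
  induction hx using Submodule.span_induction with
  | mem a ha =>
    refine ⟨1, fun f hf => ?_⟩
    have h0 := hf.2.1 a ha.1
    rw [← Complex.re_eq_norm.2 h0]
    exact hf.2.2.1 a ha.1 (by simpa using ha.2)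
  | zero =>
    refine ⟨0, ?_⟩
    rintro _ ⟨⟨φ, rfl⟩, -⟩
    simp
  | add a b _ _ iha ihb =>
    obtain ⟨C, hC⟩ := iha
    obtain ⟨D, hD⟩ := ihb
    refine ⟨C + D, fun f hf => ?_⟩
    obtain ⟨φ, rfl⟩ := hf.1
    rw [map_add]
    exact (norm_add_le _ _).trans (add_le_add (hC _ hf) (hD _ hf))
  | smul c a _ iha =>
    obtain ⟨C, hC⟩ := iha
    refine ⟨‖c‖ * C, fun f hf => ?_⟩
    obtain ⟨φ, rfl⟩ := hf.1
    rw [map_smul, norm_smul]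
    exact mul_le_mul_of_nonneg_left (hC _ hf) (norm_nonneg _)

theorem isCompact_quasiStates (J : ClosedIdeal A) : IsCompact (quasiStates J) := by
  choose C hC using exists_norm_le_of_mem_quasiStates J
  refine (isCompact_univ_pi fun x => isCompact_closedBall (0 : ℂ) (C x)).of_isClosed_subset
    (isClosed_quasiStates J) fun f hf x _ => ?_
  simpa using hC x f hf

/-- For `h ≥ 0`, the element `-h` is not a limit of sums of a nonnegative element and an element
of `J` unless `h` belongs to `J`. -/
theorem ClosedIdeal.mem_of_neg_mem_closure (J : ClosedIdeal A) {h : A} (hh : 0 ≤ h)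
    (hcl : -h ∈ closure {x : A | ∃ a j, 0 ≤ a ∧ j ∈ J ∧ a + j = x}) : h ∈ J := by
  suffices hJ : h ∈ closure (J : Set A) by
    rwa [IsClosed.closure_eq (s := (J : Set A)) J.isClosed'] at hJ
  refine Metric.mem_closure_iff.2 fun ε hε => ?_
  obtain ⟨_, ⟨a, j, ha, hj, rfl⟩, hdist⟩ := Metric.mem_closure_iff.1 hcl (ε / 8) (by positivity)
  obtain ⟨c, hc⟩ : ∃ c, c = h + a + j := ⟨_, rfl⟩
  have hcn : ‖c‖ < ε / 8 := by
    have : -(-h - (a + j)) = c := by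
      rw [hc]
      abel
    rwa [dist_eq_norm, ← norm_neg, this] at hdist
  let _ : PartialOrder J := CStarAlgebra.spectralOrder J
  have _ : StarOrderedRing J := CStarAlgebra.spectralOrderedRing J
  have hl := CStarAlgebra.increasingApproximateUnit J
  -- an element `e` of an approximate unit of `J` makes `j - j e` small
  obtain ⟨e, hej, hen, hes⟩ : ∃ e : J, ‖(j : A) - j * e‖ < ε / 8 ∧ ‖(e : A)‖ ≤ 1 ∧
      star (e : A) = e := by
    have h1 := Metric.tendsto_nhds.1 (hl.tendsto_mul_left (⟨j, hj⟩ : J)) (ε / 8) (by positivity)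
    obtain ⟨e, he1, he2, he3⟩ := (h1.and (hl.eventually_norm.and hl.eventually_star_eq)).exists
    refine ⟨e, ?_, he2, congrArg Subtype.val he3⟩
    rw [dist_comm, dist_eq_norm] at he1
    exact he1
  -- `Φ x = (1 - e) x (1 - e)` in the unitization
  obtain ⟨Φ, hΦ⟩ : ∃ Φ : A → A, ∀ x, Φ x = (x - x * e) - e * (x - x * e) := ⟨_, fun _ => rfl⟩
  have hΦadd : ∀ x y, Φ (x + y) = Φ x + Φ y := fun x y => by
    simp only [hΦ, add_mul, mul_add, mul_sub]
    abel
  have hΦnonneg : ∀ x, 0 ≤ x → 0 ≤ Φ x := fun x hx => by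
    obtain ⟨y, rfl⟩ := CStarAlgebra.nonneg_iff_eq_star_mul_self.1 hx
    have : Φ (star y * y) = star (y - y * e) * (y - y * e) := by
      simp only [hΦ, star_sub, star_mul, hes, mul_sub, sub_mul, mul_assoc]
      abel
    rw [this]
    exact star_mul_self_nonneg _
  have hΦnorm : ∀ x, ‖Φ x‖ ≤ 2 * ‖x - x * e‖ := fun x => by
    rw [hΦ]
    refine (norm_sub_le _ _).trans ?_
    have : ‖(e : A) * (x - x * e)‖ ≤ 1 * ‖x - x * e‖ :=
      (norm_mul_le _ _).trans (mul_le_mul_of_nonneg_right hen (norm_nonneg _))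
    linarith
  refine ⟨h - Φ h, ?_, ?_⟩
  · have : h - Φ h = h * e + e * (h - h * e) := by
      rw [hΦ]
      abel
    rw [this]
    exact add_mem (J.mul_mem_left _ e.2) (J.mul_mem_right _ e.2)
  · rw [dist_eq_norm, sub_sub_cancel]
    have hle : Φ h ≤ Φ (h + a) := by
      rw [hΦadd]
      exact le_add_of_nonneg_right (hΦnonneg a ha)
    have heq : Φ (h + a) = Φ c - Φ j := by
      rw [hc, hΦadd (h + a) j, add_sub_cancel_right]
    have hce : ‖c - c * e‖ ≤ 2 * ‖c‖ := by
      refine (norm_sub_le _ _).trans ?_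
      have : ‖c * (e : A)‖ ≤ ‖c‖ * 1 :=
        (norm_mul_le _ _).trans (mul_le_mul_of_nonneg_left hen (norm_nonneg _))
      linarith
    calc ‖Φ h‖ ≤ ‖Φ (h + a)‖ := CStarAlgebra.norm_le_norm_of_nonneg_of_le (hΦnonneg h hh) hle
      _ ≤ ‖Φ c‖ + ‖Φ j‖ := heq ▸ norm_sub_le _ _
      _ < ε := by linarith [hΦnorm c, hΦnorm j]

/-- Functionals in `quasiStates J` separate the nonnegative elements from the ideal `J`. This is
the Hahn–Banach theorem for the closed cone generated by the nonnegative elements and `J`. -/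
theorem exists_mem_quasiStates_pos (J : ClosedIdeal A) {h : A} (hh : 0 ≤ h) (hJ : h ∉ J) :
    ∃ f ∈ quasiStates J, 0 < (f h).re := by
  let C : PointedCone ℝ A :=
    { carrier := {x : A | ∃ a j, 0 ≤ a ∧ j ∈ J ∧ a + j = x}
      add_mem' := by
        rintro _ _ ⟨a, j, ha, hj, rfl⟩ ⟨b, k, hb, hk, rfl⟩
        exact ⟨a + b, j + k, add_nonneg ha hb, add_mem hj hk, add_add_add_comm a b j k⟩
      zero_mem' := ⟨0, 0, le_rfl, zero_mem J, add_zero 0⟩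
      smul_mem' := by
        rintro ⟨c, hc⟩ _ ⟨a, j, ha, hj, rfl⟩
        exact ⟨c • a, c • j, smul_nonneg hc ha, by
          rw [← Complex.coe_smul]
          exact SMulMemClass.smul_mem _ hj, (smul_add c a j).symm⟩ }
  have hmem : -h ∉ (Submodule.closure C : ProperCone ℝ A) :=
    fun hcl => hJ (J.mem_of_neg_mem_closure hh hcl)
  obtain ⟨g, hg, hgh⟩ := ProperCone.hyperplane_separation_point _ hmem
  have hgC : ∀ a j, 0 ≤ a → j ∈ J → 0 ≤ g (a + j) := fun a j ha hj =>
    hg _ (subset_closure (s := (C : Set A)) ⟨a, j, ha, hj, rfl⟩)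
  have hg0 : ∀ a, 0 ≤ a → 0 ≤ g a := fun a ha => by simpa using hgC a 0 ha (zero_mem J)
  have hgJ : ∀ j ∈ J, g j = 0 := fun j hj => le_antisymm
    (by simpa using hgC 0 (-j) le_rfl (neg_mem hj)) (by simpa using hgC 0 j le_rfl hj)
  -- composing `g` with the real part makes the complex functional with real part `fr` agree with
  -- `g` on self-adjoint elements
  let fr : A →ₗ[ℝ] ℝ := g.toLinearMap ∘ₗ (selfAdjoint.submodule ℝ A).subtype ∘ₗ realPart
  have hfr : ∀ x : A, fr x = g ((ℜ x : selfAdjoint A) : A) := fun _ => rfl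
  let φ : A →ₗ[ℂ] ℂ := Module.Dual.extendRCLike fr
  have hφ : ∀ x, φ x = fr x - Complex.I * fr (Complex.I • x) :=
    fun x => Module.Dual.extendRCLike_apply fr x
  have hφsa : ∀ a, IsSelfAdjoint a → φ a = g a := fun a ha => by
    rw [hφ, hfr, hfr, realPart_I_smul, ha.coe_realPart, ha.imaginaryPart]
    simp
  have hφ0 : ∀ a, 0 ≤ a → 0 ≤ φ a := fun a ha => by
    rw [hφsa a (IsSelfAdjoint.of_nonneg ha)]
    exact_mod_cast hg0 a ha
  have hfrJ : ∀ j ∈ J, fr j = 0 := fun j hj => by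
    rw [hfr, realPart_apply_coe]
    refine hgJ _ ?_
    rw [← Complex.coe_smul]
    exact SMulMemClass.smul_mem _ (add_mem hj (J.star_mem' hj))
  have hφJ : ∀ j ∈ J, φ j = 0 := fun j hj => by
    rw [hφ, hfrJ j hj, hfrJ _ (SMulMemClass.smul_mem _ hj)]
    simp
  obtain ⟨c, hc⟩ := PositiveLinearMap.exists_norm_apply_le (PositiveLinearMap.mk₀ φ hφ0)
  have hc' : ∀ a, ‖φ a‖ ≤ c * ‖a‖ := hc
  have hc0 : (0 : ℝ) < c + 1 := by positivity
  refine ⟨_, inv_smul_mem_quasiStates hφ0 hφJ hc0 fun a ha han => ?_, ?_⟩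
  · refine (Complex.re_le_norm _).trans ((hc' a).trans ?_)
    nlinarith [norm_nonneg a, c.2]
  · rw [Pi.smul_apply, Complex.smul_re, hφsa h (IsSelfAdjoint.of_nonneg hh)]
    rw [map_neg, neg_lt_zero] at hgh
    simp only [Complex.ofReal_re, smul_eq_mul]
    positivity

theorem exists_mem_extremePoints_quasiStates (J : ClosedIdeal A) {h : A} (hh : 0 ≤ h)
    (hJ : h ∉ J) : ∃ f ∈ (quasiStates J).extremePoints ℝ, f h ≠ 0 := by
  by_contra! hc
  obtain ⟨f, hf, hfh⟩ := exists_mem_quasiStates_pos J hh hJ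
  rw [← closure_convexHull_extremePoints (isCompact_quasiStates J) (convex_quasiStates J)] at hf
  have hcl : IsClosed {f : A → ℂ | f h = 0} := isClosed_eq (continuous_apply h) continuous_const
  have hconv : Convex ℝ {f : A → ℂ | f h = 0} := by
    intro f hf g hg s t _ _ _
    simp only [Set.mem_ofPred_eq] at hf hg ⊢
    simp [hf, hg]
  have : f h = 0 := closure_minimal (convexHull_min hc hconv) hcl hf
  simp [this] at hfh

/-- Extreme points of `quasiStates J` are pure: a positive functional that vanishes on `J` and is
dominated by an extreme point is a multiple of it. The norm of positive functionals is additive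
because the nonnegative elements of norm less than `1` are directed. -/
theorem exists_eq_mul_of_mem_extremePoints {J : ClosedIdeal A} {φ ψ : A →ₗ[ℂ] ℂ}
    (hφ : (φ : A → ℂ) ∈ (quasiStates J).extremePoints ℝ) (hψ0 : ∀ a, 0 ≤ a → 0 ≤ ψ a)
    (hψφ : ∀ a, 0 ≤ a → 0 ≤ (φ - ψ) a) (hψJ : ∀ j ∈ J, ψ j = 0) :
    ∃ c : ℂ, ∀ a, ψ a = c * φ a := by
  have hφS := hφ.1
  have hadd : ∀ a, φ a = ψ a + (φ - ψ) a := fun a => by simp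
  let D : Set A := {x : A | 0 ≤ x} ∩ Metric.ball 0 1
  have hD : ∀ a : A, 0 ≤ a → ‖a‖ < 1 → a ∈ D := fun a ha han => ⟨ha, by simpa using han⟩
  have hDn : ∀ a ∈ D, ‖a‖ < 1 := fun a ha => by simpa using ha.2
  have : Nonempty D := ⟨0, hD 0 le_rfl (by simp)⟩
  -- `s` and `t` below are the norms of `ψ` and `φ - ψ`; this estimate gives `s + t ≤ 1`
  have hle : ∀ a ∈ D, ∀ b ∈ D, (ψ a).re + ((φ - ψ) b).re ≤ 1 := by
    intro a ha b hb
    obtain ⟨c, hcD, hac, hbc⟩ := CStarAlgebra.directedOn_nonneg_ball a ha b hb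
    have h1 := (Complex.le_def.1 (hψ0 _ (sub_nonneg.2 hac))).1
    have h2 := (Complex.le_def.1 (hψφ _ (sub_nonneg.2 hbc))).1
    have h3 := hφS.2.2.1 c hcD.1 (hDn c hcD)
    rw [hadd c, Complex.add_re] at h3
    rw [map_sub, Complex.sub_re, Complex.zero_re] at h1 h2
    linarith
  let s : ℝ := ⨆ a : D, (ψ a).re
  let t : ℝ := ⨆ a : D, ((φ - ψ) a).re
  have h0D : (0 : A) ∈ D := hD 0 le_rfl (by simp)
  have hsb : BddAbove (Set.range fun a : D => (ψ a).re) :=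
    ⟨1, by rintro _ ⟨a, rfl⟩; simpa using hle a a.2 0 h0D⟩
  have htb : BddAbove (Set.range fun a : D => ((φ - ψ) a).re) :=
    ⟨1, by rintro _ ⟨a, rfl⟩; simpa using hle 0 h0D a a.2⟩
  have hs : ∀ a ∈ D, (ψ a).re ≤ s := fun a ha => le_ciSup hsb ⟨a, ha⟩
  have ht : ∀ a ∈ D, ((φ - ψ) a).re ≤ t := fun a ha => le_ciSup htb ⟨a, ha⟩
  have hs0 : 0 ≤ s := by simpa using hs 0 h0D
  have ht0 : 0 ≤ t := by simpa using ht 0 h0D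
  have hst : s + t ≤ 1 := by
    have : s ≤ 1 - t := ciSup_le fun a => by
      have : t ≤ 1 - (ψ a).re := ciSup_le fun b => by linarith [hle a a.2 b b.2]
      linarith
    linarith
  have hzero : ∀ χ : A →ₗ[ℂ] ℂ, (∀ a, 0 ≤ a → 0 ≤ χ a) → (∀ a ∈ D, (χ a).re ≤ 0) → χ = 0 := by
    intro χ hχ0 hχ
    refine LinearMap.ext_on CStarAlgebra.span_nonneg_inter_unitBall fun a ha => ?_
    have h0 := Complex.nonneg_iff.1 (hχ0 a ha.1)
    exact Complex.ext (le_antisymm (hχ a ha) h0.1) h0.2.symm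
  rcases hs0.eq_or_lt with hs' | hs'
  · have := hzero ψ hψ0 (hs' ▸ hs)
    exact ⟨0, fun a => by simp [this]⟩
  rcases ht0.eq_or_lt with ht' | ht'
  · have := hzero (φ - ψ) hψφ (ht' ▸ ht)
    exact ⟨1, fun a => by rw [hadd a, this]; simp⟩
  have h1 : 0 < 1 - s := by linarith
  have hψS := inv_smul_mem_quasiStates hψ0 hψJ hs' fun a ha han => hs a (hD a ha han)
  have hφψS := inv_smul_mem_quasiStates (J := J) hψφ (fun j hj => by
    simp [hψJ j hj, hφS.2.2.2 j hj]) h1 fun a ha han => (ht a (hD a ha han)).trans (by linarith)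
  -- `φ` lies strictly between `ψ / s` and `(φ - ψ) / (1 - s)`, so it is equal to the former
  have hseg : (φ : A → ℂ) ∈ openSegment ℝ (s⁻¹ • (ψ : A → ℂ))
      ((1 - s)⁻¹ • ((φ - ψ : A →ₗ[ℂ] ℂ) : A → ℂ)) := by
    refine ⟨s, 1 - s, hs', h1, by ring, ?_⟩
    rw [smul_inv_smul₀ hs'.ne', smul_inv_smul₀ h1.ne']
    ext a
    exact (hadd a).symm
  have := (mem_extremePoints.1 hφ).2 _ hψS _ hφψS hseg
  refine ⟨s, fun a => ?_⟩
  rw [← this.1, Pi.smul_apply, Complex.real_smul, ← mul_assoc, ← Complex.ofReal_mul,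
    mul_inv_cancel₀ hs'.ne', Complex.ofReal_one, one_mul]

end Existence

/-! ### Irreducible representations from pure functionals -/

section GNS

open scoped ComplexOrder InnerProductSpace
open Filter

variable {A : Type u} [NonUnitalCStarAlgebra A]

theorem map_mem_orthogonal {H : Type*} [NormedAddCommGroup H]
    [InnerProductSpace ℂ H] [CompleteSpace H] (π : A →⋆ₙₐ[ℂ] (H →L[ℂ] H)) {K : Submodule ℂ H}
    (hK : ∀ a, ∀ η ∈ K, π a η ∈ K) (a : A) : ∀ η ∈ Kᗮ, π a η ∈ Kᗮ := by
  intro η hη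
  rw [Submodule.mem_orthogonal'] at hη ⊢
  intro u hu
  rw [inner_map_left]
  exact hη _ (hK _ u hu)

variable [PartialOrder A] [StarOrderedRing A]

namespace PositiveLinearMap

/-- The canonical map from the algebra to the GNS space. -/
noncomputable def toGNS (φ : A →ₚ[ℂ] ℂ) : A →ₗ[ℂ] φ.GNS :=
  (UniformSpace.Completion.toComplₗᵢ (𝕜 := ℂ) (E := φ.PreGNS)).toLinearMap ∘ₗ
    φ.toPreGNS.toLinearMap

theorem inner_toGNS (φ : A →ₚ[ℂ] ℂ) (a b : A) :
    ⟪φ.toGNS a, φ.toGNS b⟫_ℂ = φ (star a * b) :=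
  UniformSpace.Completion.inner_coe _ _

theorem denseRange_toGNS (φ : A →ₚ[ℂ] ℂ) : DenseRange φ.toGNS :=
  UniformSpace.Completion.denseRange_coe (α := φ.PreGNS)

theorem gnsNonUnitalStarAlgHom_toGNS (φ : A →ₚ[ℂ] ℂ) (a b : A) :
    φ.gnsNonUnitalStarAlgHom a (φ.toGNS b) = φ.toGNS (a * b) :=
  φ.gnsNonUnitalStarAlgHom_apply_coe

/-- A positive functional of norm at most `1` is a vector functional in its GNS representation,
and its vector is mapped by the algebra to the canonical dense subspace. The vector comes from the
estimate `|φ(a)|² ≤ φ(a* a)`, the limit of the Cauchy–Schwarz inequality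
`|φ(e a)|² ≤ φ(e²) φ(a* a)` along an approximate unit. -/
theorem exists_cyclic_vector (φ : A →ₚ[ℂ] ℂ) (h1 : ∀ a, 0 ≤ a → ‖a‖ < 1 → (φ a).re ≤ 1) :
    ∃ ξ : φ.GNS, (∀ a, ⟪ξ, φ.toGNS a⟫_ℂ = φ a) ∧
      ∀ a, φ.gnsNonUnitalStarAlgHom a ξ = φ.toGNS a := by
  have hl := CStarAlgebra.increasingApproximateUnit A
  have hnorm : ∀ a, 0 ≤ a → ‖a‖ ≤ 1 → (φ a).re ≤ 1 := by
    intro a ha han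
    have hlim : Tendsto (fun r : ℝ => r * (φ a).re) (𝓝[<] 1) (𝓝 (1 * (φ a).re)) :=
      (tendsto_nhdsWithin_of_tendsto_nhds tendsto_id).mul tendsto_const_nhds
    rw [one_mul] at hlim
    refine le_of_tendsto hlim ?_
    filter_upwards [Ioo_mem_nhdsLT (zero_lt_one (α := ℝ))] with r hr
    have := h1 (r • a) (smul_nonneg hr.1.le ha) (by
      rw [norm_smul, Real.norm_of_nonneg hr.1.le]
      nlinarith [hr.1, hr.2, norm_nonneg a])
    rwa [← Complex.coe_smul, map_smul, smul_eq_mul, Complex.re_ofReal_mul] at this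
  have hbound : ∀ a, ‖φ a‖ ≤ 1 * ‖φ.toGNS a‖ := by
    intro a
    have hφ : Continuous φ := map_continuous φ
    have hlim := (hφ.norm.tendsto a).comp (hl.tendsto_mul_right a)
    refine le_of_tendsto hlim ?_
    filter_upwards [hl.eventually_norm, hl.eventually_star_eq] with e hen hes
    have hee : ‖φ.toGNS e‖ ≤ 1 := by
      have h2 : ‖φ.toGNS e‖ ^ 2 ≤ 1 := by
        rw [← inner_self_eq_norm_sq (𝕜 := ℂ), inner_toGNS]
        refine hnorm _ (star_mul_self_nonneg e) ?_
        rw [CStarRing.norm_star_mul_self]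
        nlinarith [norm_nonneg e]
      nlinarith [norm_nonneg (φ.toGNS e)]
    have heq : φ (e * a) = ⟪φ.toGNS e, φ.toGNS a⟫_ℂ := by rw [inner_toGNS, hes]
    change ‖φ (e * a)‖ ≤ _
    rw [heq]
    exact (norm_inner_le_norm _ _).trans (mul_le_mul_of_nonneg_right hee (norm_nonneg _))
  let ℓ : φ.GNS →L[ℂ] ℂ := (φ : A →ₗ[ℂ] ℂ).extendOfNorm φ.toGNS
  have hℓ : ∀ a, ℓ (φ.toGNS a) = φ a :=
    LinearMap.extendOfNorm_eq φ.denseRange_toGNS ⟨1, hbound⟩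
  have hξ : ∀ a, ⟪(InnerProductSpace.toDual ℂ φ.GNS).symm ℓ, φ.toGNS a⟫_ℂ = φ a := fun a => by
    rw [InnerProductSpace.toDual_symm_apply, hℓ]
  refine ⟨(InnerProductSpace.toDual ℂ φ.GNS).symm ℓ, hξ, fun a => ?_⟩
  refine ext_inner_right ℂ fun η => ?_
  refine φ.denseRange_toGNS.induction_on (p := fun η => ⟪φ.gnsNonUnitalStarAlgHom a _, η⟫_ℂ
    = ⟪φ.toGNS a, η⟫_ℂ) η (isClosed_eq (by fun_prop) (by fun_prop)) fun b => ?_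
  rw [inner_map_left, gnsNonUnitalStarAlgHom_toGNS, hξ, inner_toGNS]

end PositiveLinearMap

/-- If `K` is invariant under a representation, `v ∈ K` and `ξ - v ⟂ K`, then the functional
`a ↦ ⟪ξ, π(a) v⟫` is positive. -/
theorem inner_map_nonneg_of_sub_mem_orthogonal {H : Type*} [NormedAddCommGroup H]
    [InnerProductSpace ℂ H] [CompleteSpace H] (π : A →⋆ₙₐ[ℂ] (H →L[ℂ] H)) {K : Submodule ℂ H}
    (hK : ∀ a, ∀ η ∈ K, π a η ∈ K) {ξ v : H} (hv : v ∈ K) (hξv : ξ - v ∈ Kᗮ) {a : A}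
    (ha : 0 ≤ a) : 0 ≤ ⟪ξ, π a v⟫_ℂ := by
  have h : ⟪ξ, π a v⟫_ℂ = ⟪v, π a v⟫_ℂ := by
    rw [← sub_eq_zero, ← inner_sub_left]
    exact Submodule.inner_left_of_mem_orthogonal (hK a v hv) hξv
  obtain ⟨y, rfl⟩ := CStarAlgebra.nonneg_iff_eq_star_mul_self.1 ha
  rw [h, map_mul, mul_apply_eq_comp, ← inner_map_left]
  rw [inner_self_eq_norm_sq_to_K, ← RCLike.ofReal_pow]
  exact RCLike.ofReal_nonneg.2 (sq_nonneg _)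

/-- The GNS representation of an extreme point of `quasiStates J` is irreducible. If `v` is the
projection of the cyclic vector `ξ` to an invariant subspace, then `a ↦ ⟪ξ, π(a) v⟫` is a multiple
of `a ↦ ⟪ξ, π(a) ξ⟫`, hence `v` is a multiple of `ξ`. -/
theorem exists_irrRep_of_mem_extremePoints {J : ClosedIdeal A} {f : A → ℂ}
    (hf : f ∈ (quasiStates J).extremePoints ℝ) {h : A} (hfh : f h ≠ 0) :
    ∃ π : IrrRep A, J ≤ π.ker ∧ h ∉ π.ker := by
  have hfS := hf.1
  obtain ⟨f', rfl⟩ := hfS.1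
  let φ : A →ₚ[ℂ] ℂ := PositiveLinearMap.mk₀ f' hfS.2.1
  have hφ : ∀ a, φ a = f' a := fun _ => rfl
  obtain ⟨ξ, hξ, hπξ⟩ := φ.exists_cyclic_vector hfS.2.2.1
  let π := φ.gnsNonUnitalStarAlgHom
  have hπJ : ∀ j ∈ J, π j = 0 := by
    intro j hj
    ext η
    refine φ.denseRange_toGNS.induction_on (p := fun η => π j η = (0 : φ.GNS →L[ℂ] φ.GNS) η) η
      (isClosed_eq (by fun_prop) (by fun_prop)) fun b => ?_
    change π j (φ.toGNS b) = 0
    rw [φ.gnsNonUnitalStarAlgHom_toGNS, ← inner_self_eq_zero (𝕜 := ℂ), φ.inner_toGNS]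
    exact hfS.2.2.2 _ (J.mul_mem_left _ (J.mul_mem_right b hj))
  have hπh : π h ≠ 0 := by
    intro h0
    refine hfh ?_
    rw [← hφ, ← hξ, ← hπξ]
    change ⟪ξ, π h ξ⟫_ℂ = 0
    rw [h0]
    exact inner_zero_right ξ
  refine ⟨⟨φ.GNS, π, ⟨h, hπh⟩, fun K hKc hK => ?_⟩, hπJ, hπh⟩
  have : CompleteSpace K := hKc.completeSpace_coe
  obtain ⟨v, hv, hw⟩ : ∃ v ∈ K, ξ - v ∈ Kᗮ := ⟨K.starProjection ξ,
    K.starProjection_apply_mem ξ, K.sub_starProjection_mem_orthogonal ξ⟩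
  have hKo := map_mem_orthogonal π hK
  let ψ : A →ₗ[ℂ] ℂ :=
    { toFun := fun a => ⟪ξ, π a v⟫_ℂ
      map_add' := fun a b => by rw [map_add, add_apply, inner_add_right]
      map_smul' := fun c a => by rw [map_smul, smul_apply, inner_smul_right]; rfl }
  have hψ : ∀ a, ψ a = ⟪ξ, π a v⟫_ℂ := fun _ => rfl
  have hf' : ∀ a, f' a = ⟪ξ, π a ξ⟫_ℂ := fun a => by
    rw [← hφ, ← hξ, ← hπξ]
  have hψ0 : ∀ a, 0 ≤ a → 0 ≤ ψ a := fun a ha =>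
    inner_map_nonneg_of_sub_mem_orthogonal π hK hv hw ha
  have hψφ : ∀ a, 0 ≤ a → 0 ≤ (f' - ψ) a := fun a ha => by
    have := inner_map_nonneg_of_sub_mem_orthogonal π hKo hw
      (by rw [sub_sub_cancel]; exact K.le_orthogonal_orthogonal hv) ha
    rwa [map_sub, inner_sub_right, ← hf', ← hψ] at this
  have hψJ : ∀ j ∈ J, ψ j = 0 := fun j hj => by
    rw [hψ, hπJ j hj]
    exact inner_zero_right ξ
  obtain ⟨c, hc⟩ := exists_eq_mul_of_mem_extremePoints hf hψ0 hψφ hψJ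
  have hvξ : v = c • ξ := by
    rw [← sub_eq_zero]
    refine ext_inner_left ℂ fun η => ?_
    rw [inner_zero_right]
    refine φ.denseRange_toGNS.induction_on (p := fun η => ⟪η, v - c • ξ⟫_ℂ = 0) η
      (isClosed_eq (by fun_prop) (by fun_prop)) fun b => ?_
    rw [← hπξ, inner_map_left, map_sub, map_smul, inner_sub_right, inner_smul_right]
    change ψ (star b) - c * ⟪ξ, π (star b) ξ⟫_ℂ = 0
    rw [← hf', hc, sub_self]
  -- an invariant subspace that contains the cyclic vector is dense
  have hcyc : ∀ L : Submodule ℂ φ.GNS, IsClosed (L : Set φ.GNS) → (∀ a, ∀ η ∈ L, π a η ∈ L) →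
      ξ ∈ L → L = ⊤ := by
    intro L hL hinv hξL
    refine Submodule.eq_top_iff'.2 fun η => ?_
    refine φ.denseRange_toGNS.induction_on (p := fun η => η ∈ L) η hL fun b => ?_
    rw [← hπξ]
    exact hinv b ξ hξL
  by_cases hc0 : c = 0
  · left
    rw [hvξ, hc0, zero_smul, sub_zero] at hw
    have := hcyc Kᗮ K.isClosed_orthogonal hKo hw
    rwa [Submodule.orthogonal_eq_top_iff] at this
  · right
    refine hcyc K hKc hK ?_
    rw [hvξ] at hv
    simpa [smul_smul, hc0] using K.smul_mem c⁻¹ hv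

end GNS

theorem Submodule.eq_top_of_star_mul_self_mem {A : Type*} [NonUnitalCStarAlgebra A]
    (S : Submodule ℂ A) (h : ∀ y, star y * y ∈ S) : S = ⊤ := by
  let _ : PartialOrder A := CStarAlgebra.spectralOrder A
  have _ : StarOrderedRing A := CStarAlgebra.spectralOrderedRing A
  rw [eq_top_iff, ← CStarAlgebra.span_nonneg, Submodule.span_le]
  intro x hx
  rw [Set.mem_ofPred_eq] at hx
  obtain ⟨y, rfl⟩ := CStarAlgebra.nonneg_iff_eq_star_mul_self.1 hx
  exact h y

/-- A closed ideal is the intersection of the primitive ideals that contain it. -/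
theorem ClosedIdeal.le_of_forall_ker {A : Type u} [NonUnitalCStarAlgebra A] {I J : ClosedIdeal A}
    (h : ∀ π : IrrRep A, J ≤ π.ker → I ≤ π.ker) : I ≤ J := by
  let _ : PartialOrder A := CStarAlgebra.spectralOrder A
  have _ : StarOrderedRing A := CStarAlgebra.spectralOrderedRing A
  have htop : (I.comap J).toSubmodule = ⊤ := by
    refine Submodule.eq_top_of_star_mul_self_mem _ fun y => ?_
    by_contra hyJ
    obtain ⟨f, hf, hfy⟩ := exists_mem_extremePoints_quasiStates J
      (star_mul_self_nonneg (y : A)) hyJ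
    obtain ⟨π, hJ, hyπ⟩ := exists_irrRep_of_mem_extremePoints hf hfy
    exact hyπ (h π hJ (star y * y).2)
  intro x hx
  have : (⟨x, hx⟩ : I) ∈ (I.comap J).toSubmodule := htop ▸ Submodule.mem_top
  exact this

/-! ### Fell ranks and Fell ideals -/

section FellRank

variable {A : Type u} [NonUnitalCStarAlgebra A] {α : Ordinal.{0}}

theorem LocalSection.fellRank_le_pedersenRank (s : LocalSection A)
    (h : pedersenRank s.b ≤ α) : s.fellRank ≤ α :=
  weightRank_le_of_dominated isOpen_univ
    (continuous_subtype_val.comp continuous_subtype_val) (fun x hx => absurd (Set.mem_univ x) hx)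
    (fun _ => le_rfl) h

/-- The local section given by an element, over the set of all primitive ideals that do not
contain it. -/
def LocalSection.ofElement (a : A) : LocalSection A where
  b := a
  U := {t | a ∉ t.1}
  isOpen := isOpen_setOf_notMem a
  ne_zero _ h := h

theorem IrrRep.exists_localSection (π : IrrRep A) :
    ∃ s : LocalSection A, π.toPrim ∈ s.U ∧ s.fellRank = π.fellRank := by
  obtain ⟨a, ha⟩ := π.ne_zero
  exact csInf_mem (s := {r | ∃ s : LocalSection A, π.toPrim ∈ s.U ∧ s.fellRank = r})
    ⟨_, LocalSection.ofElement a, ha, rfl⟩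

/-- Cutting a local section `(b, U)` down by the ideal that corresponds to `U` yields elements
whose Pedersen rank is at most the Fell rank of the section. -/
theorem LocalSection.exists_pedersenRank_le (s : LocalSection A) (hs : s.fellRank ≤ α)
    {π : IrrRep A} (hπ : π.toPrim ∈ s.U) : ∃ a, pedersenRank a ≤ α ∧ π.toHom a ≠ 0 := by
  obtain ⟨I, hI⟩ := Prim.exists_eq_compl_hull s.isOpen
  have hIπ : ¬ I ≤ π.ker := by
    rw [hI] at hπ
    exact hπ
  obtain ⟨ξ, hξ⟩ : ∃ ξ, π.toHom s.b ξ ≠ 0 := by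
    by_contra! h
    exact s.ne_zero π hπ (ContinuousLinearMap.ext h)
  obtain ⟨x, hx, hxb⟩ : ∃ x ∈ I, π.toHom x (π.toHom s.b ξ) ≠ 0 := by
    by_contra! h
    exact hξ (IrrRep.eq_zero_of_forall_mem hIπ h)
  refine ⟨x * s.b, ?_, fun h => hxb ?_⟩
  · refine weightRank_le_of_dominated s.isOpen (f := id) continuous_id (fun t ht => ?_)
      (fun t => ?_) hs
    · rw [hI, Set.notMem_compl_iff] at ht
      refine le_antisymm (pedersenFunction_le_iff.2 fun ρ hρ => ?_) zero_le
      subst hρ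
      exact (IrrRep.rankOf_eq_zero (IrrRep.mem_ker.1 (ht (I.mul_mem_right _ hx)))).le
    · refine pedersenFunction_le_iff.2 fun ρ hρ => (ρ.rankOf_mul_le x s.b).trans ?_
      rw [id, ← hρ]
      exact ρ.rankOf_le_pedersenFunction s.b
  · rw [← mul_apply_eq_comp, ← map_mul, h]
    rfl

/-- An irreducible representation has Fell rank at most `α` if and only if it does not vanish on
some element of Pedersen rank at most `α`. -/
theorem IrrRep.fellRank_le_iff {π : IrrRep A} :
    π.fellRank ≤ α ↔ ∃ a, pedersenRank a ≤ α ∧ π.toHom a ≠ 0 := by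
  constructor
  · intro h
    obtain ⟨s, hπ, hs⟩ := π.exists_localSection
    exact s.exists_pedersenRank_le (hs.trans_le h) hπ
  · rintro ⟨a, ha, hπa⟩
    exact (sInf_le (show _ ∈ {r | ∃ s : LocalSection A, π.toPrim ∈ s.U ∧ s.fellRank = r} from
      ⟨LocalSection.ofElement a, hπa, rfl⟩)).trans
      ((LocalSection.ofElement a).fellRank_le_pedersenRank ha)

theorem IrrRep.lt_fellRank_iff {π : IrrRep A} :
    (α : WithTop Ordinal.{0}) < π.fellRank ↔ fellIdeal A α ≤ π.ker := by
  rw [← not_le, IrrRep.fellRank_le_iff, fellIdeal, ClosedIdeal.span_le]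
  push Not
  rfl

/-- The Pedersen rank of an element of an ideal does not depend on whether it is computed in the
ideal or in the algebra. -/
theorem pedersenRank_coe_le_iff {I : ClosedIdeal A} {x : I} :
    pedersenRank (x : A) ≤ α ↔ pedersenRank x ≤ α := by
  constructor
  · refine weightRank_le_of_dominated isOpen_univ
      (f := fun t : (Set.univ : Set (Prim I)) => extendPrim I t)
      ((continuous_extendPrim I).comp continuous_subtype_val)
      (fun x hx => absurd (Set.mem_univ x) hx) (fun t => pedersenFunction_le_iff.2 fun σ hσ => ?_)
    rw [← hσ, extendPrim_toPrim, ← σ.rankOf_extend]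
    exact σ.extend.rankOf_le_pedersenFunction _
  · refine weightRank_le_of_dominated (isClosed_hull I).isOpen_compl (continuous_restrictPrim I)
      (fun t ht => ?_) (fun t => pedersenFunction_le_iff.2 fun π hπ => ?_)
    · rw [Set.notMem_compl_iff] at ht
      refine le_antisymm (pedersenFunction_le_iff.2 fun ρ hρ => ?_) zero_le
      subst hρ
      exact (IrrRep.rankOf_eq_zero (IrrRep.mem_ker.1 (ht x.2))).le
    · obtain ⟨t, ht⟩ := t
      change π.toPrim = t at hπ
      subst hπ
      exact (π.restrict I ht).rankOf_le_pedersenFunction x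

theorem algebraFellRank_fellIdeal_le (α : Ordinal.{0}) :
    algebraFellRank (fellIdeal A α) ≤ α := by
  refine iSup_le fun σ => IrrRep.fellRank_le_iff.2 ?_
  have hσ : ¬ fellIdeal A α ≤ σ.extend.ker := fun h => by
    obtain ⟨x, hx⟩ := σ.ne_zero
    rw [← σ.extend_toHom_coe] at hx
    exact hx (h x.2)
  rw [← IrrRep.lt_fellRank_iff, not_lt, IrrRep.fellRank_le_iff] at hσ
  obtain ⟨a, ha, hσa⟩ := hσ
  have haI : a ∈ fellIdeal A α := ClosedIdeal.subset_span _ ha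
  refine ⟨⟨a, haI⟩, pedersenRank_coe_le_iff.1 ha, ?_⟩
  rwa [← σ.extend_toHom_coe]

theorem le_fellIdeal_of_algebraFellRank_le {I : ClosedIdeal A} (hI : algebraFellRank I ≤ α) :
    I ≤ fellIdeal A α := by
  refine ClosedIdeal.le_of_forall_ker fun π hπ => ?_
  by_contra hIπ
  obtain ⟨x, hx, hπx⟩ := IrrRep.fellRank_le_iff.1 ((le_iSup _ (π.restrict I hIπ)).trans hI)
  exact hπx (hπ (ClosedIdeal.subset_span _ (pedersenRank_coe_le_iff.2 hx)))

end FellRank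

theorem mainTheorem6 {A : Type u} [NonUnitalCStarAlgebra A] [TopologicalSpace.SeparableSpace A]
    (α : Ordinal.{0}) (hα : α < ω₁) :
    IsClosed (hull (fellIdeal A α)) ∧
    hull (fellIdeal A α) =
      {t : Prim A | ∃ π : IrrRep A, π.toPrim = t ∧ (α : WithTop Ordinal.{0}) < π.fellRank} ∧
    (∀ π : IrrRep A,
      (α : WithTop Ordinal.{0}) < π.fellRank ↔ fellIdeal A α ≤ π.ker) ∧
    IsGreatest {I : ClosedIdeal A | algebraFellRank I ≤ (α : WithTop Ordinal.{0})}
      (fellIdeal A α) := by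
  refine ⟨isClosed_hull _, ?_, fun π => IrrRep.lt_fellRank_iff,
    algebraFellRank_fellIdeal_le α, fun I hI => le_fellIdeal_of_algebraFellRank_le hI⟩
  ext t
  constructor
  · intro ht
    obtain ⟨_, π, rfl⟩ := t
    exact ⟨π, rfl, IrrRep.lt_fellRank_iff.2 ht⟩
  · rintro ⟨π, rfl, hπ⟩
    exact IrrRep.lt_fellRank_iff.1 hπ
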